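/- Let $q$ be an odd prime power, $k=\overline{\mathbb F}_q$ an algebraic closure of $\mathbb F_q$, and $m\ge 2$ an integer. Let $f,g\in\mathbb F_q[t]$ be non-zero and relatively prime, with $g$ monic, $\deg f<\deg g$ and the product $f\cdot g$ not a square in $k[t]$, and let $p\in\mathbb F_q[t]$ be a polynomial with $\deg p>m$. Put $\tilde f=f+g\,p^2$, let $\mathbf a=(a_0,\dots,a_m)$ be independent variables over $k$, and let $$F(\mathbf a,t)=\tilde f(t)+g(t)\Big\{\Big(\sum_{j=0}^m a_jt^j\Big)^2+2p(t)\sum_{j=0}^m a_jt^j\Big\}\in k(\mathbf a)[t].$$ Then $F(\mathbf a,t)$ is a separable polynomial in $t$ of degree $n=\deg g+2\deg p$ over $k(\mathbf a)$, and its Galois group over $k(\mathbf a)$, acting on its $n$ distinct roots, is the full symmetric group: $\mathrm{Gal}(F(\mathbf a,t),k(\mathbf a))=S_n$. -/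

import Mathlib

open scoped Polynomial

namespace GenericShortInterval

noncomputable section

/-- The rational function field `k(a) = k(a_0, ..., a_m)` in `m + 1` independent variables. -/
abbrev RatField (k : Type*) [Field k] (m : ℕ) : Type _ :=
  FractionRing (MvPolynomial (Fin (m + 1)) k)

/-- The variable `a_j` as an element of `k(a)`. -/
def param (k : Type*) [Field k] (m : ℕ) (j : Fin (m + 1)) : RatField k m :=
  algebraMap (MvPolynomial (Fin (m + 1)) k) (RatField k m) (MvPolynomial.X j)

/-- A polynomial in `t` over the base field `k₀`, viewed in `k(a)[t]`, along
`k₀ → k → k[a] → k(a)`. -/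
def lift (k₀ k : Type*) [Field k₀] [Field k] [Algebra k₀ k] (m : ℕ) :
    k₀[X] →+* (RatField k m)[X] :=
  Polynomial.mapRingHom
    ((algebraMap (MvPolynomial (Fin (m + 1)) k) (RatField k m)).comp
      (MvPolynomial.C.comp (algebraMap k₀ k)))

/-- The generic polynomial `∑_{j=0}^m a_j t^j` of degree at most `m`, in `k(a)[t]`. -/
def genericPoly (k : Type*) [Field k] (m : ℕ) : (RatField k m)[X] :=
  ∑ j : Fin (m + 1), Polynomial.C (param k m j) * Polynomial.X ^ (j : ℕ)

/-- `f̃ = f + g p²`. -/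
def fTilde {k₀ : Type*} [Field k₀] (f g p : k₀[X]) : k₀[X] := f + g * p ^ 2

/-- `F(a, t) = f̃ + g ((∑ a_j t^j)² + 2 p ∑ a_j t^j)` in `k(a)[t]`. -/
def F {k₀ : Type*} (k : Type*) [Field k₀] [Field k] [Algebra k₀ k] (m : ℕ)
    (f g p : k₀[X]) : (RatField k m)[X] :=
  lift k₀ k m (fTilde f g p) +
    lift k₀ k m g * (genericPoly k m ^ 2 + 2 * lift k₀ k m p * genericPoly k m)

/-- The action of `Gal(P, K)` on the roots of `P` in its splitting field. -/
def galRootsHom {K : Type*} [Field K] (P : K[X]) :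
    P.Gal →* Equiv.Perm (P.rootSet P.SplittingField) :=
  haveI : Fact ((P.map (algebraMap K P.SplittingField)).Splits) :=
    ⟨Polynomial.SplittingField.splits P⟩
  Polynomial.Gal.galActionHom P P.SplittingField

end

end GenericShortInterval

namespace GenericShortInterval

open Polynomial

/-! Completing the square gives F = f + g·(p + A)² with A the generic polynomial. The Galois group G
is shown to be doubly transitive and to contain a transposition, hence to be symmetric. Each
property is read off after an embedding Φ of k(a) into a larger field L that moves A along a line A
+ y·c: the group of the image of F over L acts on the roots through elements of G
(`exists_embedding_of_map`).

As a polynomial in y, f + g·(h + y·c)² is quadratic with discriminant -4fg·c², so it stays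
irreducible because -fg is not a square; Gauss's lemma carries this to irreducibility in t over
K(y). The direction c = 1 gives transitivity. The direction c = t - t₀, with t₀ a root of F, keeps
t₀ a root and makes the cofactor irreducible, so a point stabilizer is transitive on the other
roots.

For the transposition, `exists_simple_tangency` finds a member of the family with one double root
and all others simple. On the line joining it to the generic member, the simple roots lift to power
series by Hensel while the double root ramifies, so an automorphism exchanges just the remaining two
roots. The same reduction shows F' ≠ 0, hence separability. -/

/-! ### Degrees, and descent of squares. -/

theorem natDegree_add_mul_sq {K : Type*} [CommRing K] [IsDomain K] {f g p A : K[X]}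
    (hfg : f.natDegree < g.natDegree) (hA : A.natDegree < p.natDegree) :
    (f + g * (p + A) ^ 2).natDegree = g.natDegree + 2 * p.natDegree := by
  have hpA : (p + A).natDegree = p.natDegree := natDegree_add_eq_left_of_natDegree_lt hA
  have hpA0 : p + A ≠ 0 := by rintro h; rw [h, natDegree_zero] at hpA; omega
  have hg0 : g ≠ 0 := by rintro rfl; simp at hfg
  have h1 : (g * (p + A) ^ 2).natDegree = g.natDegree + 2 * p.natDegree := by
    rw [natDegree_mul hg0 (pow_ne_zero _ hpA0), natDegree_pow, hpA]
  rw [natDegree_add_eq_right_of_natDegree_lt (by omega), h1]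

theorem leadingCoeff_add_mul_sq {K : Type*} [CommRing K] [IsDomain K] {f g p A : K[X]}
    (hfg : f.natDegree < g.natDegree) (hA : A.natDegree < p.natDegree) :
    (f + g * (p + A) ^ 2).leadingCoeff = g.leadingCoeff * p.leadingCoeff ^ 2 := by
  have hpA : (p + A).natDegree = p.natDegree := natDegree_add_eq_left_of_natDegree_lt hA
  have hpA0 : p + A ≠ 0 := by rintro h; rw [h, natDegree_zero] at hpA; omega
  have hg0 : g ≠ 0 := by rintro rfl; simp at hfg
  have h1 : (g * (p + A) ^ 2).natDegree = g.natDegree + 2 * p.natDegree := by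
    rw [natDegree_mul hg0 (pow_ne_zero _ hpA0), natDegree_pow, hpA]
  rw [leadingCoeff_add_of_degree_lt (degree_lt_degree (by omega)), leadingCoeff_mul,
    leadingCoeff_pow, leadingCoeff_add_of_degree_lt' (degree_lt_degree hA)]

/-- Being a square descends along field extensions of an algebraically closed field. -/
theorem isSquare_of_isSquare_map {k K : Type*} [Field k] [IsAlgClosed k] [Field K] (i : k →+* K)
    (P : k[X]) (h : IsSquare (P.map i)) : IsSquare P := by
  induction hn : P.natDegree using Nat.strong_induction_on generalizing P with
  | _ n ih =>
    rcases Nat.eq_zero_or_pos P.natDegree with h0 | h0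
    · rw [eq_C_of_natDegree_eq_zero h0]
      obtain ⟨z, hz⟩ := IsAlgClosed.exists_pow_nat_eq (P.coeff 0) (n := 2) (by norm_num)
      exact ⟨C z, by rw [← C_mul, ← sq, hz]⟩
    · obtain ⟨a, ha⟩ := IsAlgClosed.exists_root P (by
        rw [degree_eq_natDegree (by rintro rfl; simp at h0)]
        exact_mod_cast h0.ne')
      obtain ⟨s, hs⟩ := h
      -- A root of P is a root of s, hence a double root of P; cancel its square and induct.
      have hsa : s.IsRoot (i a) := by
        have h1 : (P.map i).eval (i a) = 0 := by
          rw [eval_map_apply, ha.eq_zero, map_zero]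
        rw [hs, eval_mul, mul_self_eq_zero] at h1
        exact h1
      obtain ⟨s₁, rfl⟩ := dvd_iff_isRoot.mpr hsa
      obtain ⟨P₁, rfl⟩ := dvd_iff_isRoot.mpr ha
      have hX : (X - C (i a)) ≠ 0 := X_sub_C_ne_zero _
      have h2 : P₁.map i = (X - C (i a)) * (s₁ * s₁) := by
        apply mul_left_cancel₀ hX
        have : (X - C (i a)) * P₁.map i = ((X - C a) * P₁).map i := by simp
        rw [this, hs]; ring
      have hP₁a : P₁.IsRoot a := by
        have h1 : i (P₁.eval a) = 0 := by
          rw [← eval_map_apply, h2]; simp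
        exact (map_eq_zero i).mp h1
      obtain ⟨P₂, rfl⟩ := dvd_iff_isRoot.mpr hP₁a
      have h3 : P₂.map i = s₁ * s₁ := by
        apply mul_left_cancel₀ hX
        rw [← h2]; simp
      have hP₂ : P₂ ≠ 0 := by rintro rfl; simp at h0
      obtain ⟨u, rfl⟩ := ih P₂.natDegree (by
        rw [← hn, natDegree_mul (X_sub_C_ne_zero _) (mul_ne_zero (X_sub_C_ne_zero _) hP₂),
          natDegree_mul (X_sub_C_ne_zero _) hP₂, natDegree_X_sub_C]
        omega) P₂ ⟨s₁, h3⟩ rfl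
      exact ⟨(X - C a) * u, by ring⟩

/-- An element of an integrally closed domain that is a square in the fraction field is a
square. -/
theorem isSquare_of_isSquare_algebraMap {R L : Type*} [CommRing R] [IsDomain R]
    [IsIntegrallyClosed R] [Field L] [Algebra R L] [IsFractionRing R L] {x : R}
    (h : IsSquare (algebraMap R L x)) : IsSquare x := by
  obtain ⟨z, hz⟩ := h
  obtain ⟨y, rfl⟩ := IsIntegrallyClosed.exists_algebraMap_eq_of_isIntegral_pow (R := R) (n := 2)
    (x := z) (by norm_num) (by rw [sq, ← hz]; exact isIntegral_algebraMap)
  exact ⟨y, IsFractionRing.injective R L (by rw [hz, map_mul])⟩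

/-! ### Irreducibility of the quadratic pencil. -/

/-- A root z in K(t) would give (g(Dz + h))² = -fg. Primitivity holds because w is coprime to g, so
a common divisor of the coefficients divides both D and h. -/
theorem irreducible_quadratic_pencil {K : Type*} [Field K] (h2 : (2 : K) ≠ 0)
    {f g h D w : K[X]} (hg : g ≠ 0) (hfg : IsCoprime f g) (hsq : ¬ IsSquare (-(f * g)))
    (hDw : f + g * h ^ 2 = D * w) (hDh : IsCoprime D h) (hD : D ≠ 0) :
    Irreducible (C w + C (2 * g * h) * X + C (g * D) * X ^ 2 : K[X][X]) := by
  have hgD : g * D ≠ 0 := mul_ne_zero hg hD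
  have hdeg : (C w + C (2 * g * h) * X + C (g * D) * X ^ 2 : K[X][X]).natDegree = 2 := by
    compute_degree!
  have h2' : IsUnit (2 : K[X]) := by
    have : (2 : K[X]) = C 2 := (map_ofNat C 2).symm
    rw [this]; exact isUnit_C.mpr (isUnit_iff_ne_zero.mpr h2)
  have hwg : IsCoprime w g := by
    have : IsCoprime (D * w) g := by
      rw [← hDw]; exact hfg.add_mul_left_left (h ^ 2)
    exact this.of_mul_left_right
  have hprim : (C w + C (2 * g * h) * X + C (g * D) * X ^ 2 : K[X][X]).IsPrimitive := by
    intro r hr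
    rw [C_dvd_iff_dvd_coeff] at hr
    have h0 : r ∣ w := by simpa [coeff_X, coeff_C] using hr 0
    have h1 : r ∣ 2 * g * h := by
      simpa [coeff_X, coeff_C, coeff_X_pow, -map_mul, coeff_C_mul] using hr 1
    have h2 : r ∣ g * D := by
      simpa [coeff_X, coeff_C, coeff_X_pow, -map_mul, coeff_C_mul] using hr 2
    have hrg : IsCoprime r g := hwg.of_isCoprime_of_dvd_left h0
    have hrD : r ∣ D := hrg.dvd_of_dvd_mul_left h2
    have hrh : r ∣ h := by
      rw [mul_assoc] at h1
      exact hrg.dvd_of_dvd_mul_left ((IsUnit.dvd_mul_left h2').mp h1)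
    exact hDh.isUnit_of_dvd' hrD hrh
  rw [hprim.irreducible_iff_irreducible_map_fraction_map (K := FractionRing K[X])]
  have hinj := IsFractionRing.injective K[X] (FractionRing K[X])
  apply irreducible_of_degree_le_three_of_not_isRoot
  · rw [natDegree_map_eq_of_injective hinj, hdeg]; simp
  · intro z hz
    apply hsq
    apply isSquare_of_isSquare_algebraMap (L := FractionRing K[X])
    set ι := algebraMap K[X] (FractionRing K[X])
    refine ⟨ι g * (ι D * z + ι h), ?_⟩
    have hz' : ι w + ι 2 * ι g * ι h * z + ι g * ι D * z ^ 2 = 0 := by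
      simpa [IsRoot, eval_map, eval₂_add, eval₂_mul] using hz
    have hDw' : ι f + ι g * ι h ^ 2 = ι D * ι w := by
      rw [← map_pow, ← map_mul, ← map_add, hDw, map_mul]
    rw [map_neg, map_mul]
    rw [map_ofNat] at hz'
    linear_combination (-ι D * ι g) * hz' - ι g * hDw'

/-- Irreducibility of `f + g (h + y D)²`, divided by its obvious factor `D`, over `K(y)`. -/
theorem exists_irreducible_factor {K : Type*} [Field K] (h2 : (2 : K) ≠ 0)
    {f g h D w : K[X]} (hg : g ≠ 0) (hfg : IsCoprime f g) (hsq : ¬ IsSquare (-(f * g)))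
    (hDw : f + g * h ^ 2 = D * w) (hDh : IsCoprime D h) (hD : D ≠ 0)
    (hw : w.natDegree ≠ 0)
    (L : Type*) [Field L] [Algebra K[X] L] [IsFractionRing K[X] L] (ι : K →+* L)
    (hι : ι = (algebraMap K[X] L).comp C) :
    ∃ Q : L[X], Irreducible Q ∧
      f.map ι + g.map ι * (h.map ι + C (algebraMap K[X] L X) * D.map ι) ^ 2 = D.map ι * Q := by
  subst hι
  set Q₀ : K[X][X] := C w + C (2 * g * h) * X + C (g * D) * X ^ 2 with hQ₀
  have hirr : Irreducible Q₀ := irreducible_quadratic_pencil h2 hg hfg hsq hDw hDh hD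
  -- Irreducibility is known with y as the variable over K[t]; the swap makes t the variable over
  -- K[y], where Gauss's lemma applies once the t-degree is positive. Setting y = 0 recovers w,
  -- which is nonconstant.
  have hirr' : Irreducible (Bivariate.swap Q₀) := (MulEquiv.irreducible_iff _).mpr hirr
  have hQ₁ : Bivariate.swap Q₀ =
      w.map C + 2 * g.map C * h.map C * C X + g.map C * D.map C * C X ^ 2 := by
    rw [hQ₀]
    simp only [map_add, map_mul, map_pow, Bivariate.swap_C, Bivariate.swap_Y, map_ofNat]
  have hdeg : (Bivariate.swap Q₀).natDegree ≠ 0 := by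
    have h1 : (Bivariate.swap Q₀).map (evalRingHom 0) = w := by
      rw [hQ₁]
      simp [Polynomial.map_map]
      have : (evalRingHom (0 : K)).comp C = RingHom.id K := by ext; simp
      simp [this]
    intro h0
    apply hw
    have := natDegree_map_le (f := evalRingHom (0 : K)) (p := Bivariate.swap Q₀)
    rw [h1] at this
    omega
  refine ⟨(Bivariate.swap Q₀).map (algebraMap K[X] L),
    ((hirr'.isPrimitive hdeg).irreducible_iff_irreducible_map_fraction_map (K := L)).mp hirr', ?_⟩
  rw [hQ₁]
  have hDw' := congrArg (Polynomial.map ((algebraMap K[X] L).comp C)) hDw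
  simp only [Polynomial.map_add, Polynomial.map_mul, Polynomial.map_pow, Polynomial.map_map,
    Polynomial.map_ofNat, map_C] at hDw' ⊢
  linear_combination hDw'

/-! ### Galois action through an embedding of the base field. -/

/-- Every automorphism of an overfield `M` of `K` in which `P` splits acts on the roots of `P` as
some element of the Galois group of `P`. -/
theorem exists_gal_apply {K M : Type*} [Field K] [Field M] [Algebra K M] (P : K[X])
    (ι : P.SplittingField →ₐ[K] M) (σ : M ≃ₐ[K] M) :
    ∃ τ : P.Gal, ∀ x : P.rootSet P.SplittingField,
      ι (galRootsHom P τ x : P.SplittingField) = σ (ι x) := by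
  have : Fact ((P.map (algebraMap K P.SplittingField)).Splits) :=
    ⟨Polynomial.SplittingField.splits P⟩
  obtain ⟨σ', hσ'⟩ : ∃ σ' : P.SplittingField ≃ₐ[K] P.SplittingField,
      ∀ x, ι (σ' x) = σ (ι x) := by
    let _ := ι.toRingHom.toAlgebra
    have : IsScalarTower K P.SplittingField M :=
      IsScalarTower.of_algebraMap_eq fun x => (ι.commutes x).symm
    exact ⟨σ.restrictNormal P.SplittingField,
      fun x => AlgEquiv.restrictNormal_commutes σ P.SplittingField x⟩
  refine ⟨Gal.restrict P P.SplittingField σ', fun x => ?_⟩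
  rw [← hσ']
  congr 1
  exact Gal.galActionHom_restrict P P.SplittingField σ' x

/-- Restriction of automorphisms over an overfield `L` of `K` to the roots of `P`. -/
theorem exists_embedding_of_map {K L : Type*} [Field K] [Field L] (P : K[X]) (Φ : K →+* L)
    (M : Type*) [Field M] [Algebra L M] [IsSplittingField L M (P.map Φ)] :
    ∃ j : P.SplittingField →+* M,
      (∀ x, j (algebraMap K _ x) = algebraMap L _ (Φ x)) ∧
      (∀ z : M, aeval z (P.map Φ) = 0 → P ≠ 0 → ∃ r : P.rootSet P.SplittingField, j r = z) ∧
      ∀ σ : M ≃ₐ[L] M, ∃ τ : P.Gal, ∀ x : P.rootSet P.SplittingField,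
          j (galRootsHom P τ x : P.SplittingField) = σ (j x) := by
  let _ : Algebra K L := Φ.toAlgebra
  let _ : Algebra K M := ((algebraMap L M).comp Φ).toAlgebra
  have : IsScalarTower K L M := IsScalarTower.of_algebraMap_eq fun _ => rfl
  have hM : algebraMap K M = (algebraMap L M).comp Φ := rfl
  have hs : (P.map (algebraMap K M)).Splits := by
    rw [hM, ← Polynomial.map_map]; exact IsSplittingField.splits M (P.map Φ)
  let ι : P.SplittingField →ₐ[K] M := IsSplittingField.lift _ P hs
  refine ⟨ι.toRingHom, fun x => ι.commutes x, fun z hz hP => ?_, fun σ =>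
    exists_gal_apply P ι (σ.restrictScalars K)⟩
  have hz' : z ∈ P.rootSet M := by
    rw [mem_rootSet]
    refine ⟨hP, ?_⟩
    rw [aeval_def, ← eval_map, hM, ← Polynomial.map_map, eval_map, ← aeval_def, hz]
  rw [← (SplittingField.splits P).image_rootSet ι] at hz'
  obtain ⟨r, hr, hrz⟩ := hz'
  exact ⟨⟨r, hr⟩, hrz⟩

theorem aeval_map_of_mem_rootSet {K L M : Type*} [Field K] [Field L] [Field M] [Algebra L M]
    {P : K[X]} {Φ : K →+* L} {j : P.SplittingField →+* M}
    (hj : ∀ x, j (algebraMap K _ x) = algebraMap L _ (Φ x))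
    (r : P.rootSet P.SplittingField) : aeval (j r) (P.map Φ) = 0 := by
  have h1 := (mem_rootSet.mp r.2).2
  have h2 : (algebraMap L M).comp Φ = j.comp (algebraMap K _) :=
    RingHom.ext fun x => (hj x).symm
  rw [aeval_def, eval₂_map, h2, ← hom_eval₂, ← aeval_def, h1, map_zero]

/-- Automorphisms over L fix the rational root ρ, and all roots other than ρ are conjugate over L
because they share the irreducible polynomial Q. -/
theorem exists_stabilizer_transitive {K L : Type*} [Field K] [Field L] {P : K[X]} (hP : P ≠ 0)
    (Φ : K →+* L) {ρ : L} {Q : L[X]} (hQ : Irreducible Q) (h : P.map Φ = (X - C ρ) * Q) :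
    ∃ r : P.rootSet P.SplittingField, ∀ x y, x ≠ r → y ≠ r →
      ∃ τ : P.Gal, galRootsHom P τ r = r ∧ galRootsHom P τ x = y := by
  let M := (P.map Φ).SplittingField
  obtain ⟨j, hj, hjr, hjσ⟩ := exists_embedding_of_map P Φ M
  have : Normal L M := Normal.of_isSplittingField (P.map Φ)
  have haev : ∀ z : M, aeval z (P.map Φ) = (z - algebraMap L M ρ) * aeval z Q := fun z => by
    simpa using congrArg (aeval z) h
  obtain ⟨r, hr⟩ := hjr (algebraMap L M ρ) (by rw [haev, sub_self, zero_mul]) hP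
  have key : ∀ x : P.rootSet P.SplittingField, x ≠ r → aeval (j x) Q = 0 := by
    intro x hx
    have h1 := aeval_map_of_mem_rootSet hj x
    rw [haev] at h1
    refine (mul_eq_zero.mp h1).resolve_left fun h2 => hx ?_
    rw [sub_eq_zero, ← hr] at h2
    exact Subtype.ext (j.injective h2)
  refine ⟨r, fun x y hx hy => ?_⟩
  obtain ⟨σ, hσ⟩ := minpoly.exists_algEquiv_of_root (K := L) (x := j x) (y := j y)
    (Algebra.IsAlgebraic.isAlgebraic _) (by
      rw [minpoly.eq_of_irreducible hQ (key y hy) |>.symm, map_mul, key x hx, zero_mul])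
  obtain ⟨τ, hτ⟩ := hjσ σ
  refine ⟨τ, Subtype.ext (j.injective ?_), Subtype.ext (j.injective ?_)⟩
  · rw [hτ, hr, σ.commutes]
  · rw [hτ, hσ]

/-- Some L-automorphism moves a root, since P does not split over L. It fixes every root rational
over L, which leaves at most two roots to move. -/
theorem exists_swap_mem_range {K L : Type*} [Field K] [Field L] {P : K[X]} (hP : P.Separable)
    (Φ : K →+* L) (hns : ¬ (P.map Φ).Splits) (S : Finset L)
    (hS : ∀ x ∈ S, (P.map Φ).IsRoot x) (hcard : P.natDegree ≤ S.card + 2) :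
    ∃ (u v : P.rootSet P.SplittingField) (τ : P.Gal), u ≠ v ∧
      ∀ [DecidableEq (P.rootSet P.SplittingField)], galRootsHom P τ = Equiv.swap u v := by
  classical
  let M := (P.map Φ).SplittingField
  obtain ⟨j, hj, hjr, hjσ⟩ := exists_embedding_of_map P Φ M
  have hgal : IsGalois L M := IsGalois.of_separable_splitting_field (p := P.map Φ) (hP.map)
  have : FiniteDimensional L M := IsSplittingField.finiteDimensional M (P.map Φ)
  have hP0 := hP.ne_zero
  obtain ⟨u, hu⟩ : ∃ u : P.rootSet P.SplittingField, j u ∉ (algebraMap L M).range := by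
    by_contra! hcon
    apply hns
    refine (IsSplittingField.splits M (P.map Φ)).of_splits_map_of_injective
      (FaithfulSMul.algebraMap_injective L M) fun a ha => ?_
    obtain ⟨r, rfl⟩ := hjr a (by
      rw [aeval_def, ← eval_map]; exact (mem_roots'.mp ha).2) hP0
    exact hcon r
  obtain ⟨σ, hσ⟩ : ∃ σ : M ≃ₐ[L] M, σ (j u) ≠ j u := by
    by_contra! hcon
    have := (IsGalois.mem_bot_iff_fixed (F := L) (j u)).mpr hcon
    exact hu (IntermediateField.mem_bot.mp this)
  obtain ⟨τ, hτ⟩ := hjσ σ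
  set π := galRootsHom P τ
  have hfix : ∀ x : P.rootSet P.SplittingField, j x ∈ (algebraMap L M).range → π x = x := by
    rintro x ⟨y, hy⟩
    exact Subtype.ext (j.injective (by rw [hτ, ← hy, σ.commutes]))
  have huv : π u ≠ u := fun h => hσ (by rw [← hτ, h])
  have hv : j (π u) ∉ (algebraMap L M).range := fun h => huv (π.injective (hfix _ h))
  have hroot : ∀ x : S, ∃ r : P.rootSet P.SplittingField, j r = algebraMap L M x := fun x =>
    hjr _ (by rw [aeval_algebraMap_apply, coe_aeval_eq_eval, (hS x x.2).eq_zero, map_zero]) hP0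
  choose e he using hroot
  have he_inj : Function.Injective e := fun x y hxy =>
    Subtype.ext ((algebraMap L M).injective (by rw [← he, ← he, hxy]))
  have hmem : ∀ x, x = u ∨ x = π u ∨ j x ∈ (algebraMap L M).range := by
    have h1 : u ∉ insert (π u) (Finset.univ.image e) := by
      rw [Finset.mem_insert, Finset.mem_image]
      rintro (h | ⟨x, -, h⟩)
      · exact huv h.symm
      · exact hu ⟨x, by rw [← he, h]⟩
    have h2 : π u ∉ Finset.univ.image e := by
      rw [Finset.mem_image]
      rintro ⟨x, -, h⟩
      exact hv ⟨x, by rw [← he, h]⟩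
    have h3 : insert u (insert (π u) (Finset.univ.image e)) = Finset.univ := by
      apply Finset.eq_univ_of_card
      apply le_antisymm (Finset.card_le_univ _)
      rw [Finset.card_insert_of_notMem h1, Finset.card_insert_of_notMem h2,
        Finset.card_image_of_injective _ he_inj, Finset.card_univ, Fintype.card_coe,
        card_rootSet_eq_natDegree hP (SplittingField.splits P)]
      exact hcard
    intro x
    have := Finset.mem_univ x
    rw [← h3, Finset.mem_insert, Finset.mem_insert, Finset.mem_image] at this
    rcases this with h | h | ⟨y, -, rfl⟩
    · exact Or.inl h
    · exact Or.inr (Or.inl h)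
    · exact Or.inr (Or.inr ⟨y, (he y).symm⟩)
  refine ⟨u, π u, τ, huv.symm, fun {_} => Equiv.ext fun x => ?_⟩
  have hv2 : π (π u) = u := by
    rcases hmem (π (π u)) with h | h | h
    · exact h
    · exact absurd (π.injective h) huv
    · exact absurd (π.injective (π.injective (hfix _ h))) huv
  rcases hmem x with rfl | rfl | h
  · rw [Equiv.swap_apply_left]
  · rw [Equiv.swap_apply_right]; exact hv2
  · rw [Equiv.swap_apply_of_ne_of_ne]
    · exact hfix x h
    · rintro rfl; exact hu h
    · rintro rfl; exact hv h

/-- Transitivity together with a transitive point stabilizer gives double transitivity, by routing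
pairs through r; every transposition is then conjugate to the given one. -/
theorem galRootsHom_bijective {K : Type*} [Field K] {P : K[X]} (hirr : Irreducible P)
    (hstab : ∃ r : P.rootSet P.SplittingField, ∀ x y, x ≠ r → y ≠ r →
      ∃ τ : P.Gal, galRootsHom P τ r = r ∧ galRootsHom P τ x = y)
    (hswap : ∃ (u v : P.rootSet P.SplittingField) (τ : P.Gal), u ≠ v ∧
      ∀ [DecidableEq (P.rootSet P.SplittingField)], galRootsHom P τ = Equiv.swap u v) :
    Function.Bijective (galRootsHom P) := by
  classical
  have : Fact ((P.map (algebraMap K P.SplittingField)).Splits) :=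
    ⟨Polynomial.SplittingField.splits P⟩
  refine ⟨Gal.galActionHom_injective P P.SplittingField, ?_⟩
  have htrans : ∀ x y, ∃ τ : P.Gal, galRootsHom P τ x = y :=
    (Gal.galAction_isPretransitive P P.SplittingField hirr).exists_smul_eq
  obtain ⟨r, hr⟩ := hstab
  obtain ⟨u, v, τ, huv, hτ⟩ := hswap
  have h2 : ∀ x y : P.rootSet P.SplittingField, x ≠ y →
      ∃ τ : P.Gal, galRootsHom P τ u = x ∧ galRootsHom P τ v = y := by
    intro x y hxy
    obtain ⟨α, hα⟩ := htrans u r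
    obtain ⟨β, hβ⟩ := htrans x r
    obtain ⟨γ, hγ, hγ'⟩ := hr (galRootsHom P α v) (galRootsHom P β y)
      (fun h => huv ((galRootsHom P α).injective (hα.trans h.symm)))
      (fun h => hxy ((galRootsHom P β).injective (hβ.trans h.symm)))
    refine ⟨β⁻¹ * γ * α, ?_, ?_⟩
    · rw [map_mul, map_mul, map_inv, Equiv.Perm.mul_apply, Equiv.Perm.mul_apply, hα, hγ,
        Equiv.Perm.inv_eq_iff_eq, hβ]
    · rw [map_mul, map_mul, map_inv, Equiv.Perm.mul_apply, Equiv.Perm.mul_apply, hγ',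
        Equiv.Perm.inv_eq_iff_eq]
  rw [← MonoidHom.range_eq_top, eq_top_iff, ← Equiv.Perm.closure_isSwap, Subgroup.closure_le]
  rintro _ ⟨x, y, hxy, rfl⟩
  obtain ⟨γ, rfl, rfl⟩ := h2 x y hxy
  refine ⟨γ * τ * γ⁻¹, ?_⟩
  rw [map_mul, map_mul, map_inv, hτ, Equiv.swap_apply_apply]

/-! ### A member of the family with a single simple tangency. -/

theorem exists_eval_ne_zero {k : Type*} [Field k] [Infinite k] {P : k[X]} (hP : P ≠ 0) :
    ∃ x, P.eval x ≠ 0 := by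
  by_contra! h
  exact hP (Polynomial.funext fun x => by rw [h x, eval_zero])

theorem sq_X_sub_C_dvd {k : Type*} [Field k] {P : k[X]} {a : k} (h : P.eval a = 0)
    (h' : (derivative P).eval a = 0) : (X - C a) ^ 2 ∣ P := by
  obtain ⟨P₁, rfl⟩ := dvd_iff_isRoot.mpr h
  have : P₁.IsRoot a := by simpa [derivative_mul] using h'
  obtain ⟨P₂, rfl⟩ := dvd_iff_isRoot.mpr this
  exact ⟨P₂, by ring⟩

theorem not_isSquare_neg {k : Type*} [Field k] [IsAlgClosed k] {P : k[X]} (h : ¬ IsSquare P) :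
    ¬ IsSquare (-P) := by
  rintro ⟨R, hR⟩
  obtain ⟨i, hi⟩ := IsAlgClosed.exists_pow_nat_eq (-1 : k) (n := 2) (by norm_num)
  have hi' : (C i : k[X]) ^ 2 = -1 := by rw [← C_pow, hi]; simp
  exact h ⟨C i * R, by linear_combination -hR - R * R * hi'⟩

/-- Vanishing would give (gV)² = -fg·W², making -fg a square because k[t] is integrally closed. -/
theorem mul_sq_add_mul_sq_ne_zero {k : Type*} [Field k] [IsAlgClosed k] {f g V : k[X]}
    (hg : g ≠ 0) (hsq : ¬ IsSquare (f * g)) (hV : V ≠ 0) (W : k[X]) :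
    g * V ^ 2 + f * W ^ 2 ≠ 0 := by
  intro h
  have hW : W ≠ 0 := by
    rintro rfl
    simp [hg, hV] at h
  have h1 : W ^ 2 ∣ (g * V) ^ 2 := ⟨-(f * g), by linear_combination g * h⟩
  obtain ⟨R, hR⟩ := (IsIntegrallyClosed.pow_dvd_pow_iff two_ne_zero).mp h1
  refine not_isSquare_neg hsq ⟨R, mul_left_cancel₀ (pow_ne_zero 2 hW) ?_⟩
  linear_combination g * h * (-1) + (g * V + W * R) * hR

/-- If the last expression vanished for two base points, subtracting would give f'g - g'f = 0 and
then 4fg = 0. -/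
theorem exists_base_point {k : Type*} [Field k] [Infinite k] (h2 : (2 : k) ≠ 0) {f g : k[X]}
    (hf : f ≠ 0) (hg : g ≠ 0) :
    ∃ τ : k, f.eval τ ≠ 0 ∧ g.eval τ ≠ 0 ∧
      (derivative f * g - derivative g * f) * (X - C τ) - 4 * f * g ≠ 0 := by
  obtain ⟨a, ha⟩ := exists_eval_ne_zero (mul_ne_zero hf hg)
  obtain ⟨b, hb⟩ := exists_eval_ne_zero (mul_ne_zero (mul_ne_zero hf hg) (X_sub_C_ne_zero a))
  simp only [eval_mul, mul_ne_zero_iff] at ha hb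
  by_contra! hcon
  have h1 := hcon a ha.1 ha.2
  have h3 := hcon b hb.1.1 hb.1.2
  have hab : (C b - C a : k[X]) ≠ 0 := by
    rw [← C_sub, Ne, C_eq_zero]; simpa using hb.2
  have h4 : derivative f * g - derivative g * f = 0 :=
    (mul_eq_zero.mp (show (C b - C a) * (derivative f * g - derivative g * f) = 0 by
      linear_combination h1 - h3)).resolve_left hab
  rw [h4] at h1
  have h5 : (4 : k[X]) = C (2 * 2) := by rw [C_mul, map_ofNat]; norm_num
  have h6 : (4 : k[X]) ≠ 0 := by rw [h5, Ne, C_eq_zero]; exact mul_ne_zero h2 h2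
  exact mul_ne_zero (mul_ne_zero h6 hf) hg (by linear_combination -h1)

/-- Some member of the family `f + g (p + A)²`, `deg A ≤ 2`, has exactly one multiple root, and
that root is double. -/
theorem exists_simple_tangency {k : Type*} [Field k] [IsAlgClosed k] (h2 : (2 : k) ≠ 0)
    {f g : k[X]} (p : k[X]) (hf : f ≠ 0) (hg : g ≠ 0) (hfg : IsCoprime f g)
    (hsq : ¬ IsSquare (f * g)) :
    ∃ (A S : k[X]) (τ : k), A.natDegree ≤ 2 ∧ f + g * (p + A) ^ 2 = (X - C τ) ^ 2 * S ∧
      S.eval τ ≠ 0 ∧ S.Separable ∧ g.eval τ ≠ 0 ∧ (p + A).eval τ ≠ 0 := by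
  have : Infinite k := IsAlgClosed.instInfinite
  obtain ⟨τ, hfτ, hgτ, hV⟩ := exists_base_point h2 hf hg
  set V := (derivative f * g - derivative g * f) * (X - C τ) - 4 * f * g with hVdef
  -- s₀ and s₁ are the value and derivative at τ forced on h₀ for f + g·h₀² to vanish there doubly.
  -- Adding b(t - τ)² keeps this and leaves b free.
  obtain ⟨s₀, hs₀⟩ := IsAlgClosed.exists_pow_nat_eq (-f.eval τ / g.eval τ) (n := 2) (by norm_num)
  have hs₀' : f.eval τ + g.eval τ * s₀ ^ 2 = 0 := by rw [hs₀]; field_simp; ring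
  have hs₀0 : s₀ ≠ 0 := by rintro rfl; simp [hfτ] at hs₀'
  set s₁ := -((derivative f).eval τ + (derivative g).eval τ * s₀ ^ 2) / (2 * g.eval τ * s₀) with hs₁
  have hs₁' : (derivative f).eval τ + (derivative g).eval τ * s₀ ^ 2 +
      2 * g.eval τ * s₀ * s₁ = 0 := by
    rw [hs₁]; field_simp; ring
  set A₀ := C (s₀ - p.eval τ) + C (s₁ - (derivative p).eval τ) * (X - C τ) with hA₀
  set h₀ := p + A₀ with hh₀
  have hh₀τ : h₀.eval τ = s₀ := by simp [hh₀, hA₀]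
  have hh₀τ' : (derivative h₀).eval τ = s₁ := by simp [hh₀, hA₀]
  obtain ⟨w, hw⟩ : (X - C τ) ^ 2 ∣ f + g * h₀ ^ 2 := by
    apply sq_X_sub_C_dvd
    · simp [hh₀τ, hs₀']
    · simp only [derivative_add, derivative_mul, derivative_sq, eval_add, eval_mul, eval_pow,
        hh₀τ, hh₀τ', eval_C]
      linear_combination hs₁'
  -- At another multiple root t, with s = h(t), eliminating b between f + gs² = 0 and its derivative
  -- gives V + sW = 0, hence E(t) = 0. As E does not involve b, only finitely many t are candidates.
  set W := g ^ 2 * (2 * derivative h₀ * (X - C τ) - 4 * h₀) with hW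
  have hE := mul_sq_add_mul_sq_ne_zero hg hsq hV W
  set E := g * V ^ 2 + f * W ^ 2 with hEdef
  classical
  let T := E.roots.toFinset.erase τ
  -- B t is S(t) as a polynomial in b; choosing b off its roots excludes the candidate t.
  let B : k → k[X] := fun t =>
    C (w.eval t) + C (2 * g.eval t * h₀.eval t) * X + C (g.eval t * (t - τ) ^ 2) * X ^ 2
  have hB : ∀ t ∈ T, B t ≠ 0 := by
    intro t ht h0
    have htτ : t - τ ≠ 0 := sub_ne_zero.mpr (Finset.ne_of_mem_erase ht)
    have hc0 : w.eval t = 0 := by simpa [B, coeff_X] using congrArg (fun P => coeff P 0) h0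
    have hc2 : g.eval t = 0 := by
      simpa [B, coeff_X, coeff_C, coeff_X_pow, htτ, -map_mul] using
        congrArg (fun P => coeff P 2) h0
    have hft : f.eval t = 0 := by
      have := congrArg (eval t) hw
      simpa [hc0, hc2] using this
    obtain ⟨a, b, hab⟩ := hfg
    have := congrArg (eval t) hab
    simp [hft, hc2] at this
  have hB₀ : (C (w.eval τ) + C (2 * g.eval τ * s₀) * X : k[X]) ≠ 0 := by
    intro h0
    have := congrArg (fun P => coeff P 1) h0
    simp [coeff_C, h2, hgτ, hs₀0, -map_mul] at this
  obtain ⟨b, hb⟩ := exists_eval_ne_zero (mul_ne_zero hB₀ (Finset.prod_ne_zero_iff.mpr hB))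
  rw [eval_mul, mul_ne_zero_iff, eval_prod, Finset.prod_ne_zero_iff] at hb
  set S := w + 2 * C b * g * h₀ + C b ^ 2 * g * (X - C τ) ^ 2 with hS
  have hSτ : S.eval τ ≠ 0 := by
    intro h0
    apply hb.1
    simp only [hS, eval_add, eval_mul, eval_pow, eval_C, eval_sub, eval_X, hh₀τ, eval_ofNat] at h0 ⊢
    linear_combination h0
  have hF : f + g * (p + (A₀ + C b * (X - C τ) ^ 2)) ^ 2 = (X - C τ) ^ 2 * S := by
    rw [hS]; linear_combination hw
  refine ⟨A₀ + C b * (X - C τ) ^ 2, S, τ, ?_, hF, hSτ, ?_, hgτ, ?_⟩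
  · rw [hA₀]; compute_degree
  · rw [separable_def, isCoprime_iff_aeval_ne_zero_of_isAlgClosed k k]
    intro t
    by_contra! hcon
    obtain ⟨h0, h1⟩ := hcon
    rw [coe_aeval_eq_eval] at h0 h1
    have htτ : t ≠ τ := by rintro rfl; exact hSτ h0
    have hd : t - τ ≠ 0 := sub_ne_zero.mpr htτ
    have e0 := congrArg (eval t) hF
    have e1 := congrArg (fun P => eval t (derivative P)) hF
    simp only [derivative_add, derivative_mul, derivative_sq, eval_add, eval_mul, eval_pow,
      eval_C, eval_sub, eval_X, h0, h1, derivative_C, derivative_sub, derivative_X,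
      mul_zero, add_zero, zero_mul, sub_zero, mul_one, zero_add] at e0 e1
    have hh₀t : h₀.eval t = p.eval t + A₀.eval t := by rw [hh₀, eval_add]
    have hh₀t' : (derivative h₀).eval t = (derivative p).eval t + (derivative A₀).eval t := by
      rw [hh₀, derivative_add, eval_add]
    set s := p.eval t + (A₀.eval t + b * (t - τ) ^ 2) with hs
    have hVW : V.eval t + s * W.eval t = 0 := by
      simp only [hVdef, hW, eval_sub, eval_mul, eval_pow, eval_X, eval_C, eval_ofNat,
        hh₀t, hh₀t']
      linear_combination g.eval t * (t - τ) * e1 -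
        ((t - τ) * (derivative g).eval t + 4 * g.eval t) * e0 + 4 * g.eval t ^ 2 * s * hs
    have hEt : E.eval t = 0 := by
      simp only [hEdef, eval_add, eval_mul, eval_pow]
      linear_combination (W.eval t) ^ 2 * e0 + g.eval t * (V.eval t - s * W.eval t) * hVW
    have htT : t ∈ T := Finset.mem_erase.mpr
      ⟨htτ, by rw [Multiset.mem_toFinset, mem_roots hE]; exact hEt⟩
    apply hb.2 t htT
    simp only [hS, B, eval_add, eval_mul, eval_pow, eval_C, eval_sub, eval_X, eval_ofNat] at h0 ⊢
    linear_combination h0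
  · simp only [eval_add, eval_mul, eval_pow, eval_C, eval_sub, eval_X, sub_self]
    rw [show p.eval τ + (A₀.eval τ + b * 0 ^ 2) = s₀ by
      linear_combination hh₀τ - (eval_add : (p + A₀).eval τ = _)]
    exact hs₀0

/-! ### Power series roots near a tangency. -/

/-- **Hensel's lemma** over formal power series. -/
theorem exists_root_lift {K : Type*} [Field K] {P : (PowerSeries K)[X]} (hP : P.Monic) {a : K}
    (h₀ : (P.map PowerSeries.constantCoeff).eval a = 0)
    (h₁ : (derivative (P.map PowerSeries.constantCoeff)).eval a ≠ 0) :
    ∃ ρ : PowerSeries K, P.IsRoot ρ ∧ PowerSeries.constantCoeff ρ = a := by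
  have ha : PowerSeries.constantCoeff (PowerSeries.C a) = a := by simp
  have hmem : ∀ z : PowerSeries K,
      z ∈ Ideal.span {(PowerSeries.X : PowerSeries K)} ↔ PowerSeries.constantCoeff z = 0 :=
    fun z => by rw [Ideal.mem_span_singleton, PowerSeries.X_dvd_iff]
  obtain ⟨ρ, hρ, hρa⟩ := HenselianRing.is_henselian
    (I := Ideal.span {(PowerSeries.X : PowerSeries K)}) P hP (PowerSeries.C a)
    (by rw [hmem, ← eval_map_apply, ha, h₀])
    (by
      apply IsUnit.map
      rw [PowerSeries.isUnit_iff_constantCoeff, isUnit_iff_ne_zero, ← eval_map_apply, ha,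
        ← derivative_map]
      exact h₁)
  refine ⟨ρ, hρ, ?_⟩
  rw [hmem, map_sub, ha, sub_eq_zero] at hρa
  exact hρa

theorem constantCoeff_eval_map_C {K : Type*} [Field K] (P : K[X]) (ρ : PowerSeries K) :
    PowerSeries.constantCoeff ((P.map PowerSeries.C).eval ρ) =
      P.eval (PowerSeries.constantCoeff ρ) := by
  rw [← eval_map_apply, Polynomial.map_map]
  have : (PowerSeries.constantCoeff (R := K)).comp PowerSeries.C = RingHom.id K := by ext; simp
  rw [this, Polynomial.map_id]

/-- No root of `f + g (h + x c)²` over `K⟦x⟧` specializes to the double root of `f + g h²`. -/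
theorem constantCoeff_ne_of_isRoot {K : Type*} [Field K] (h2 : (2 : K) ≠ 0)
    {f g h c S : K[X]} {τ : K} (hF : f + g * h ^ 2 = (X - C τ) ^ 2 * S)
    (hg : g.eval τ ≠ 0) (hh : h.eval τ ≠ 0) (hc : c.eval τ ≠ 0) {ρ : PowerSeries K}
    (hρ : (f.map PowerSeries.C + g.map PowerSeries.C * (h.map PowerSeries.C +
      C PowerSeries.X * c.map PowerSeries.C) ^ 2).IsRoot ρ) :
    PowerSeries.constantCoeff ρ ≠ τ := by
  intro hτ
  obtain ⟨z, hz⟩ : PowerSeries.X ∣ ρ - PowerSeries.C τ := by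
    rw [PowerSeries.X_dvd_iff]; simp [hτ]
  have e := congrArg (fun P => (P.map PowerSeries.C).eval ρ) hF
  simp only [Polynomial.map_add, Polynomial.map_mul, Polynomial.map_pow, Polynomial.map_sub,
    map_X, map_C, eval_add, eval_mul, eval_pow, eval_sub, eval_X, eval_C, IsRoot.def] at e hρ
  set F := (f.map PowerSeries.C).eval ρ
  set G := (g.map PowerSeries.C).eval ρ with hG
  set H := (h.map PowerSeries.C).eval ρ with hH
  set D := (c.map PowerSeries.C).eval ρ with hD
  set T := (S.map PowerSeries.C).eval ρ
  -- With ρ = τ + xz the double root contributes only order x², so the term 2x·g·h·c, nonzero at τ,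
  -- cannot cancel.
  have h3 : PowerSeries.X * (2 * G * H * D + PowerSeries.X * (z ^ 2 * T + G * D ^ 2)) = 0 := by
    rw [hz] at e
    linear_combination hρ - e
  have h4 := (mul_eq_zero.mp h3).resolve_left PowerSeries.X_ne_zero
  have h5 := congrArg PowerSeries.constantCoeff h4
  simp only [map_add, map_mul, PowerSeries.constantCoeff_X, zero_mul, add_zero, map_zero,
    map_ofNat, hG, hH, hD, constantCoeff_eval_map_C, hτ] at h5
  exact mul_ne_zero (mul_ne_zero (mul_ne_zero h2 hg) hh) hc h5

/-- Near a simple tangency, `f + g (h + x c)²` has all but two of its roots in the fraction field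
of `K⟦x⟧`, but does not split there. -/
theorem not_splits_and_exists_roots {K : Type*} [Field K] (h2 : (2 : K) ≠ 0)
    {f g h c S : K[X]} {τ : K} (hF : f + g * h ^ 2 = (X - C τ) ^ 2 * S)
    (hg : g.eval τ ≠ 0) (hh : h.eval τ ≠ 0) (hc : c.eval τ ≠ 0)
    (hSτ : S.eval τ ≠ 0) (hS : S.Separable) (hSs : S.Splits)
    (hfg : f.natDegree < g.natDegree) (hch : c.natDegree < h.natDegree)
    (L : Type*) [Field L] [Algebra (PowerSeries K) L] [IsFractionRing (PowerSeries K) L]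
    (ι : K →+* L) (hι : ι = (algebraMap (PowerSeries K) L).comp PowerSeries.C) {P : L[X]}
    (hP : P = f.map ι + g.map ι * (h.map ι + C (algebraMap (PowerSeries K) L PowerSeries.X) * c.map ι) ^ 2) :
    ¬ P.Splits ∧ derivative P ≠ 0 ∧ ∃ T : Finset L, (∀ x ∈ T, P.IsRoot x) ∧
      g.natDegree + 2 * h.natDegree ≤ T.card + 2 := by
  classical
  set κ := PowerSeries.C (R := K) with hκ
  have hκinj : Function.Injective κ := PowerSeries.C_injective
  have hLinj := IsFractionRing.injective (PowerSeries K) L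
  set P₀ := f.map κ + g.map κ * (h.map κ + C PowerSeries.X * c.map κ) ^ 2 with hP₀
  have hPP₀ : P = P₀.map (algebraMap _ L) := by
    rw [hP, hP₀, hι]
    simp [Polynomial.map_map]
  have hlc₀ : P₀.leadingCoeff = κ (g.leadingCoeff * h.leadingCoeff ^ 2) := by
    rw [hP₀, leadingCoeff_add_mul_sq, leadingCoeff_map_of_injective hκinj,
      leadingCoeff_map_of_injective hκinj, map_mul, map_pow]
    · rwa [natDegree_map_eq_of_injective hκinj, natDegree_map_eq_of_injective hκinj]
    · refine (natDegree_C_mul_le _ _).trans_lt ?_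
      rwa [natDegree_map_eq_of_injective hκinj, natDegree_map_eq_of_injective hκinj]
  set l := g.leadingCoeff * h.leadingCoeff ^ 2 with hl
  have hl0 : l ≠ 0 := by
    have hg0 : g ≠ 0 := by rintro rfl; simp at hg
    have hh0 : h ≠ 0 := by rintro rfl; simp at hh
    exact mul_ne_zero (leadingCoeff_ne_zero.mpr hg0)
      (pow_ne_zero _ (leadingCoeff_ne_zero.mpr hh0))
  have hli : κ l⁻¹ ≠ 0 := by rw [Ne, map_eq_zero_iff _ hκinj]; exact inv_ne_zero hl0
  -- The leading coefficient is a constant because deg c < deg h, so it can be normalized over K⟦x⟧.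
  set P₁ := C (κ l⁻¹) * P₀ with hP₁
  have hmonic : P₁.Monic := by
    rw [Monic, hP₁, leadingCoeff_mul, leadingCoeff_C, hlc₀, ← map_mul, inv_mul_cancel₀ hl0,
      map_one]
  have hroot : ∀ ρ, P₁.IsRoot ρ ↔ P₀.IsRoot ρ := fun ρ => by
    simp only [hP₁, IsRoot.def, eval_mul, eval_C, mul_eq_zero, hli, false_or]
  have hred : P₁.map PowerSeries.constantCoeff = C l⁻¹ * ((X - C τ) ^ 2 * S) := by
    have : (PowerSeries.constantCoeff (R := K)).comp κ = RingHom.id K := by ext; simp [hκ]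
    rw [hP₁, hP₀, ← hF]
    simp [Polynomial.map_map, hκ]
  refine ⟨?_, ?_, ?_⟩
  · intro hsp
    -- K⟦x⟧ is integrally closed, so the roots of the monic P₁ would be power series, one of them
    -- reducing to τ.
    have hsp₀ : P₁.Splits := by
      refine Splits.of_splits_map_of_injective (i := algebraMap _ L) hLinj ?_ fun a ha => ?_
      · rw [hP₁, Polynomial.map_mul, map_C, ← hPP₀]
        exact (Splits.C _).mul hsp
      · have h1 : eval₂ (algebraMap _ L) a P₁ = 0 := by
          rw [← eval_map]; exact (mem_roots'.mp ha).2
        exact (IsIntegrallyClosed.isIntegral_iff (R := PowerSeries K)).mp ⟨P₁, hmonic, h1⟩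
    have h1 : (P₁.map PowerSeries.constantCoeff).eval τ = 0 := by rw [hred]; simp
    rw [hsp₀.eq_prod_roots_of_monic hmonic, Polynomial.map_multiset_prod, eval_multiset_prod,
      Multiset.prod_eq_zero_iff] at h1
    simp only [Multiset.mem_map, exists_exists_and_eq_and] at h1
    obtain ⟨ρ, hρ, h3⟩ := h1
    simp only [Polynomial.map_sub, map_X, map_C, eval_sub, eval_X, eval_C, sub_eq_zero] at h3
    exact constantCoeff_ne_of_isRoot h2 hF hg hh hc
      ((hroot ρ).mp (mem_roots'.mp hρ).2) h3.symm
  · intro hd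
    rw [hPP₀, derivative_map, Polynomial.map_eq_zero_iff hLinj] at hd
    have h1 : derivative (P₁.map PowerSeries.constantCoeff) = 0 := by
      rw [derivative_map, hP₁, derivative_C_mul, hd, mul_zero, Polynomial.map_zero]
    rw [hred, derivative_C_mul, mul_eq_zero, C_eq_zero, or_iff_right (inv_ne_zero hl0)] at h1
    have h3 : (X - C τ) * (2 * S + (X - C τ) * derivative S) = 0 := by
      rw [← h1]
      simp only [derivative_mul, derivative_sq, derivative_X_sub_C, map_ofNat]
      ring
    have h4 := congrArg (eval τ) ((mul_eq_zero.mp h3).resolve_left (X_sub_C_ne_zero τ))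
    simp [h2, hSτ] at h4
  · have hlift : ∀ a : S.roots.toFinset, ∃ ρ, P₁.IsRoot ρ ∧ PowerSeries.constantCoeff ρ = a := by
      rintro ⟨a, ha⟩
      rw [Multiset.mem_toFinset, mem_roots'] at ha
      have ha0 : S.eval a = 0 := ha.2
      have haτ : a - τ ≠ 0 := by
        intro h; rw [sub_eq_zero] at h; exact hSτ (h ▸ ha0)
      apply exists_root_lift hmonic
      · rw [hred]; simp [ha0]
      · have h1 := hS.eval₂_derivative_ne_zero (RingHom.id K) (x := a) (by simpa using ha0)
        rw [hred]
        simp only [derivative_mul, derivative_C, eval_add, eval_mul, ha0, eval_C, eval_pow,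
          eval_sub, eval_X, mul_zero, zero_mul, zero_add]
        exact mul_ne_zero (inv_ne_zero hl0) (mul_ne_zero (pow_ne_zero 2 haτ) (by simpa using h1))
    choose e he hec using hlift
    have hinj : Function.Injective fun a => algebraMap (PowerSeries K) L (e a) := by
      intro a b hab
      apply Subtype.ext
      rw [← hec, ← hec, hLinj hab]
    refine ⟨Finset.univ.map ⟨_, hinj⟩, ?_, ?_⟩
    · intro x hx
      obtain ⟨a, -, rfl⟩ := Finset.mem_map.mp hx
      rw [hPP₀]
      exact ((hroot _).mp (he a)).map
    · rw [Finset.card_map, Finset.card_univ, Fintype.card_coe,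
        Multiset.toFinset_card_of_nodup (nodup_roots hS), ← hSs.natDegree_eq_card_roots]
      have h1 := natDegree_add_mul_sq (p := h) (A := 0) hfg (by rw [natDegree_zero]; omega)
      have hS0 : S ≠ 0 := by rintro rfl; simp at hSτ
      rw [add_zero, hF, natDegree_mul (pow_ne_zero 2 (X_sub_C_ne_zero τ)) hS0, natDegree_pow,
        natDegree_X_sub_C] at h1
      omega

/-! ### Deforming the generic parameters. -/

theorem irreducible_of_map {K L : Type*} [Field K] [Field L] (Φ : K →+* L) {P : K[X]}
    (h : Irreducible (P.map Φ)) : Irreducible P := by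
  refine IsPrimitive.irreducible_of_irreducible_map_of_injective Φ.injective (fun r hr => ?_) h
  rw [isUnit_iff_ne_zero]
  rintro rfl
  rw [C_0, zero_dvd_iff] at hr
  exact h.ne_zero (by rw [hr, Polynomial.map_zero])

/-- The inclusion `k → k(a)`. -/
noncomputable def constHom (k : Type*) [Field k] (m : ℕ) : k →+* RatField k m :=
  (algebraMap (MvPolynomial (Fin (m + 1)) k) (RatField k m)).comp MvPolynomial.C

theorem lift_eq_map {k₀ k : Type*} [Field k₀] [Field k] [Algebra k₀ k] (m : ℕ) (P : k₀[X]) :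
    lift k₀ k m P = (P.map (algebraMap k₀ k)).map (constHom k m) := by
  rw [Polynomial.map_map]; rfl

theorem F_eq {k₀ : Type*} (k : Type*) [Field k₀] [Field k] [Algebra k₀ k] (m : ℕ) (f g p : k₀[X]) :
    F k m f g p = lift k₀ k m f + lift k₀ k m g * (lift k₀ k m p + genericPoly k m) ^ 2 := by
  simp only [F, fTilde, map_add, map_mul, map_pow]
  ring

theorem natDegree_genericPoly_le (k : Type*) [Field k] (m : ℕ) :
    (genericPoly k m).natDegree ≤ m :=
  natDegree_sum_le_of_forall_le _ _ fun j _ =>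
    (natDegree_C_mul_X_pow_le _ _).trans (Nat.lt_succ_iff.mp j.2)

/-- The parameter values (0, …, 0) and (1, 0, …, 0) give 0 and 1. This ensures that the direction
used near the tangency does not vanish at τ. -/
theorem eval_genericPoly_ne {k : Type*} [Field k] (m : ℕ) (c d : k) :
    (genericPoly k m).eval (constHom k m c) ≠ constHom k m d := by
  intro h
  have h1 : (∑ j : Fin (m + 1), MvPolynomial.X j * MvPolynomial.C c ^ (j : ℕ) :
      MvPolynomial (Fin (m + 1)) k) = MvPolynomial.C d := by
    apply IsFractionRing.injective (MvPolynomial (Fin (m + 1)) k) (RatField k m)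
    simpa [genericPoly, param, constHom, eval_finsetSum] using h
  have h2 := congrArg (MvPolynomial.eval fun _ => (0 : k)) h1
  have h3 := congrArg (MvPolynomial.eval fun j : Fin (m + 1) => if j = 0 then (1 : k) else 0) h1
  simp at h2 h3
  exact one_ne_zero (h3.trans h2.symm)

/-- Moving the parameters along the line `a + y c` embeds `k(a)` into every field containing
`K[y]`, where `K` is an extension of `k(a)` and `c` has coefficients in `K`. -/
theorem exists_deformation {k K L : Type*} [Field k] [Field K] [Field L] {m : ℕ}
    (j : RatField k m →+* K) (ψ : K[X] →+* L) (hψ : Function.Injective ψ) {c : K[X]}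
    (hc : c.natDegree ≤ m) :
    ∃ Φ : RatField k m →+* L,
      Φ.comp (constHom k m) = (ψ.comp C).comp (j.comp (constHom k m)) ∧
      (genericPoly k m).map Φ =
        ((genericPoly k m).map j).map (ψ.comp C) + C (ψ X) * c.map (ψ.comp C) := by
  set A := MvPolynomial (Fin (m + 1)) k
  let φ : A →+* K[X] := MvPolynomial.eval₂Hom (C.comp (j.comp (constHom k m)))
    fun i => C (j (param k m i)) + X * C (c.coeff i)
  -- At y = 0 the deformation is `j` itself, so φ is injective and extends to fractions.
  have hφ₀ : (evalRingHom 0).comp φ = j.comp (algebraMap A (RatField k m)) := by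
    apply MvPolynomial.ringHom_ext
    · intro x; simp [φ, constHom, A]
    · intro i; simp [φ, param, A]
  have hφ : Function.Injective φ := by
    have h1 : Function.Injective ((evalRingHom 0).comp φ) := by
      rw [hφ₀]
      exact j.injective.comp (IsFractionRing.injective A (RatField k m))
    exact Function.Injective.of_comp h1
  have hinj : Function.Injective (ψ.comp φ) := hψ.comp hφ
  let Φ : RatField k m →+* L := IsFractionRing.lift hinj
  have hΦ : ∀ x : A, Φ (algebraMap A (RatField k m) x) = ψ (φ x) := fun x =>
    IsFractionRing.lift_algebraMap hinj x
  refine ⟨Φ, ?_, ?_⟩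
  · ext x
    simp only [constHom, RingHom.comp_apply]
    rw [hΦ]
    exact congrArg ψ (MvPolynomial.eval₂Hom_C _ _ x)
  · have hcs : c = ∑ i : Fin (m + 1), C (c.coeff i) * X ^ (i : ℕ) := by
      conv_lhs => rw [c.as_sum_range_C_mul_X_pow' (Nat.lt_succ_iff.mpr hc)]
      rw [Finset.sum_range]
    have hparam : ∀ i, Φ (param k m i) = ψ (C (j (param k m i))) + ψ X * ψ (C (c.coeff i)) := by
      intro i
      rw [param, hΦ, ← map_mul, ← map_add]
      simp [φ, param, A]
    conv_rhs => rw [hcs]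
    simp only [genericPoly, Polynomial.map_sum, Polynomial.map_mul, Polynomial.map_pow, map_X,
      map_C, hparam, RingHom.comp_apply, Finset.mul_sum, ← Finset.sum_add_distrib, C_add, C_mul]
    exact Finset.sum_congr rfl fun i _ => by ring

theorem exists_map_F {k₀ k K L : Type*} [Field k₀] [Field k] [Algebra k₀ k] [Field K] [Field L]
    {m : ℕ} (f g p : k₀[X]) (j : RatField k m →+* K) (ψ : K[X] →+* L)
    (hψ : Function.Injective ψ) {c : K[X]} (hc : c.natDegree ≤ m) :
    ∃ Φ : RatField k m →+* L, (F k m f g p).map Φ =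
      ((lift k₀ k m f).map j).map (ψ.comp C) + ((lift k₀ k m g).map j).map (ψ.comp C) *
        (((lift k₀ k m p + genericPoly k m).map j).map (ψ.comp C) +
          C (ψ X) * c.map (ψ.comp C)) ^ 2 := by
  obtain ⟨Φ, hΦ, hA⟩ := exists_deformation j ψ hψ hc
  have hlift : ∀ q : k₀[X], (lift k₀ k m q).map Φ = ((lift k₀ k m q).map j).map (ψ.comp C) := by
    intro q
    simp only [lift_eq_map, Polynomial.map_map, RingHom.comp_assoc]
    rw [← RingHom.comp_assoc, hΦ, RingHom.comp_assoc, RingHom.comp_assoc, RingHom.comp_assoc]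
  refine ⟨Φ, ?_⟩
  rw [F_eq]
  simp only [Polynomial.map_add, Polynomial.map_mul, Polynomial.map_pow, hlift, hA]
  ring

/-! ### Three specializations of F. -/

section Generic

variable {k₀ k : Type*} [Field k₀] [Field k] [Algebra k₀ k] {m : ℕ}
  {f g p : k₀[X]}

theorem not_isSquare_neg_lift [IsAlgClosed k] {K : Type*} [Field K]
    (hsq : ¬ IsSquare ((f * g).map (algebraMap k₀ k))) (j : RatField k m →+* K) :
    ¬ IsSquare (-((lift k₀ k m f).map j * (lift k₀ k m g).map j)) := by
  intro h
  refine not_isSquare_neg hsq (isSquare_of_isSquare_map (j.comp (constHom k m)) _ ?_)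
  convert h using 1
  simp [lift_eq_map, Polynomial.map_map, RingHom.comp_assoc]

theorem natDegree_lift (q : k₀[X]) : (lift k₀ k m q).natDegree = q.natDegree := by
  rw [lift_eq_map, natDegree_map, natDegree_map]

theorem natDegree_F (hdeg : f.natDegree < g.natDegree) (hp : m < p.natDegree) :
    (F k m f g p).natDegree = g.natDegree + 2 * p.natDegree := by
  rw [F_eq, natDegree_add_mul_sq, natDegree_lift, natDegree_lift]
  · rwa [natDegree_lift, natDegree_lift]
  · rw [natDegree_lift]; exact (natDegree_genericPoly_le k m).trans_lt hp

theorem isCoprime_lift {K : Type*} [Field K] (hfg : IsCoprime f g) (j : RatField k m →+* K) :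
    IsCoprime ((lift k₀ k m f).map j) ((lift k₀ k m g).map j) :=
  (hfg.map (lift k₀ k m)).map (mapRingHom j)

theorem lift_ne_zero {q : k₀[X]} (hq : q ≠ 0) : lift k₀ k m q ≠ 0 := by
  rwa [lift_eq_map, Ne, Polynomial.map_eq_zero, Polynomial.map_eq_zero]

theorem irreducible_F [IsAlgClosed k] (h2 : (2 : k) ≠ 0) (hfg : IsCoprime f g)
    (hdeg : f.natDegree < g.natDegree) (hsq : ¬ IsSquare ((f * g).map (algebraMap k₀ k)))
    (hp : m < p.natDegree) : Irreducible (F k m f g p) := by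
  have hg0 : g ≠ 0 := by rintro rfl; simp at hdeg
  have h2' : (2 : RatField k m) ≠ 0 := by
    rw [← map_ofNat (constHom k m) 2, Ne, map_eq_zero]; exact h2
  have hsq' := not_isSquare_neg_lift hsq (RingHom.id (RatField k m))
  rw [Polynomial.map_id, Polynomial.map_id] at hsq'
  let L := FractionRing (RatField k m)[X]
  obtain ⟨Q, hQ, hFQ⟩ := exists_irreducible_factor h2' (lift_ne_zero hg0)
    (hfg.map (lift k₀ k m)) hsq' (h := lift k₀ k m p + genericPoly k m) (D := 1)
    (w := F k m f g p) (by rw [one_mul, F_eq]) isCoprime_one_left one_ne_zero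
    (by rw [natDegree_F hdeg hp]; omega) L _ rfl
  obtain ⟨Φ, hΦ⟩ := exists_map_F f g p (RingHom.id (RatField k m)) (algebraMap _ L)
    (IsFractionRing.injective _ L) (c := 1) (by simp)
  simp only [Polynomial.map_id] at hΦ
  rw [hFQ, Polynomial.map_one, one_mul] at hΦ
  exact irreducible_of_map Φ (hΦ ▸ hQ)

/-- The direction X - t, available as m ≥ 1, keeps a root t of F fixed. -/
theorem exists_stabilizer_transitive_F [IsAlgClosed k] (h2 : (2 : k) ≠ 0) (hf : f ≠ 0)
    (hfg : IsCoprime f g)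
    (hdeg : f.natDegree < g.natDegree) (hsq : ¬ IsSquare ((f * g).map (algebraMap k₀ k)))
    (hm : 1 ≤ m) (hp : m < p.natDegree) :
    ∃ r : (F k m f g p).rootSet (F k m f g p).SplittingField, ∀ x y, x ≠ r → y ≠ r →
      ∃ τ : (F k m f g p).Gal, galRootsHom _ τ r = r ∧ galRootsHom _ τ x = y := by
  have hg0 : g ≠ 0 := by rintro rfl; simp at hdeg
  have hirr : Irreducible (F k m f g p) := irreducible_F h2 hfg hdeg hsq hp
  have hn := natDegree_F (k := k) hdeg hp
  set P := F k m f g p with hP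
  let K := P.SplittingField
  set j : RatField k m →+* K := algebraMap (RatField k m) K with hj
  have h2' : (2 : K) ≠ 0 := by
    rw [← map_ofNat (j.comp (constHom k m)) 2, Ne, map_eq_zero]; exact h2
  obtain ⟨t, ht⟩ : ∃ t : K, (P.map j).eval t = 0 :=
    (SplittingField.splits P).exists_eval_eq_zero (by
      rw [degree_map, degree_eq_natDegree hirr.ne_zero, hn]
      exact_mod_cast (by omega))
  obtain ⟨w, hw⟩ := dvd_iff_isRoot.mpr ht
  have hPj : P.map j = (lift k₀ k m f).map j + (lift k₀ k m g).map j *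
      ((lift k₀ k m p + genericPoly k m).map j) ^ 2 :=
    (congrArg (Polynomial.map j) (F_eq k m f g p)).trans (by simp)
  -- If p + A vanished at t, so would f; then F, irreducible, would divide the nonzero f of smaller
  -- degree.
  have hh : IsCoprime (X - C t) ((lift k₀ k m p + genericPoly k m).map j) := by
    refine (irreducible_X_sub_C t).coprime_iff_not_dvd.mpr fun hd => ?_
    have h0 : ((lift k₀ k m f).map j).eval t = 0 := by
      have h1 := ht
      rw [hPj, eval_add, eval_mul, eval_pow, (dvd_iff_isRoot.mp hd).eq_zero] at h1
      simpa using h1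
    have hf0 := lift_ne_zero (k := k) (m := m) hf
    have h1 : P ∣ lift k₀ k m f := by
      have h3 := minpoly.dvd (RatField k m) t (p := lift k₀ k m f) (by
        rw [aeval_def, ← eval_map]; exact h0)
      rw [← minpoly.eq_of_irreducible hirr (x := t)
        (by rw [aeval_def, ← eval_map]; exact ht)] at h3
      exact (dvd_mul_right _ _).trans h3
    have h3 := natDegree_le_of_dvd h1 hf0
    rw [hn, natDegree_lift] at h3
    omega
  let L := FractionRing K[X]
  obtain ⟨Q, hQ, hFQ⟩ := exists_irreducible_factor h2'
    ((Polynomial.map_ne_zero_iff j.injective).mpr (lift_ne_zero hg0))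
    (isCoprime_lift hfg j) (not_isSquare_neg_lift hsq j)
    (h := (lift k₀ k m p + genericPoly k m).map j) (D := X - C t) (w := w)
    (by rw [← hPj, hw]) hh (X_sub_C_ne_zero t)
    (by
      intro h0
      have h1 := congrArg natDegree hw
      have hw0 : w ≠ 0 := by
        rintro rfl
        rw [mul_zero, Polynomial.map_eq_zero] at hw
        exact hirr.ne_zero hw
      rw [natDegree_map, hn, natDegree_mul (X_sub_C_ne_zero t) hw0, natDegree_X_sub_C, h0] at h1
      omega) L _ rfl
  obtain ⟨Φ, hΦ⟩ := exists_map_F f g p j (algebraMap _ L)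
    (IsFractionRing.injective _ L) (c := X - C t) (by rw [natDegree_X_sub_C]; exact hm)
  refine exists_stabilizer_transitive hirr.ne_zero Φ hQ (ρ := algebraMap K[X] L (C t)) ?_
  exact (hΦ.trans hFQ).trans (by simp)

theorem exists_tangent_specialization [IsAlgClosed k] (h2 : (2 : k) ≠ 0) (hf : f ≠ 0)
    (hfg : IsCoprime f g)
    (hdeg : f.natDegree < g.natDegree) (hsq : ¬ IsSquare ((f * g).map (algebraMap k₀ k)))
    (hm : 2 ≤ m) (hp : m < p.natDegree) (L : Type*) [Field L]
    [Algebra (PowerSeries (RatField k m)) L] [IsFractionRing (PowerSeries (RatField k m)) L] :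
    ∃ Φ : RatField k m →+* L, ¬ ((F k m f g p).map Φ).Splits ∧
      derivative ((F k m f g p).map Φ) ≠ 0 ∧
      ∃ T : Finset L, (∀ x ∈ T, ((F k m f g p).map Φ).IsRoot x) ∧
        (F k m f g p).natDegree ≤ T.card + 2 := by
  have hg0 : g ≠ 0 := by rintro rfl; simp at hdeg
  set i := constHom k m
  set α := algebraMap k₀ k
  have h2' : (2 : RatField k m) ≠ 0 := by
    rw [← map_ofNat i 2]; exact (map_ne_zero i).mpr h2
  obtain ⟨A, S, τ, hA, hF, hSτ, hS, hgτ, hhτ⟩ := exists_simple_tangency h2 (p.map α)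
    ((Polynomial.map_ne_zero_iff α.injective).mpr hf)
    ((Polynomial.map_ne_zero_iff α.injective).mpr hg0) (hfg.map (mapRingHom α))
    (by rwa [← Polynomial.map_mul])
  have hev : ∀ P : k[X], (P.map i).eval (i τ) = i (P.eval τ) := fun P => eval_map_apply i τ
  have hAp : (A.map i).natDegree < (lift k₀ k m p).natDegree := by
    rw [natDegree_map, natDegree_lift]; omega
  have hhdeg : (lift k₀ k m p + A.map i).natDegree = p.natDegree := by
    rw [natDegree_add_eq_left_of_natDegree_lt hAp, natDegree_lift]
  have hh : lift k₀ k m p + A.map i = (p.map α + A).map i := by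
    rw [lift_eq_map, Polynomial.map_add]
  have hcdeg : (genericPoly k m - A.map i).natDegree ≤ m :=
    (natDegree_sub_le_of_le (natDegree_genericPoly_le k m)
      (natDegree_map_le.trans hA)).trans (max_le le_rfl hm)
  -- The substitution y = x - 1 puts the generic member at x = 1 and the tangent one at x = 0: A_gen
  -- + (x - 1)(A_gen - A) = A + x(A_gen - A). The direction has degree at most m because deg A ≤ 2 ≤
  -- m.
  let ψ₀ : (RatField k m)[X] →+* PowerSeries (RatField k m) :=
    (coeToPowerSeries.ringHom (R := RatField k m)).comp
      (algEquivAevalXAddC (-1 : RatField k m)).toRingEquiv.toRingHom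
  have hψ₀ : Function.Injective ψ₀ :=
    (Polynomial.coe_injective (RatField k m)).comp
      (algEquivAevalXAddC (-1 : RatField k m)).injective
  let ψ : (RatField k m)[X] →+* L := (algebraMap (PowerSeries (RatField k m)) L).comp ψ₀
  have hψ : Function.Injective ψ :=
    (IsFractionRing.injective (PowerSeries (RatField k m)) L).comp hψ₀
  have hψC : ψ.comp C = (algebraMap (PowerSeries (RatField k m)) L).comp PowerSeries.C := by
    ext x; simp [ψ, ψ₀]
  have hψX : ψ X = algebraMap (PowerSeries (RatField k m)) L PowerSeries.X - 1 := by
    simp [ψ, ψ₀, sub_eq_add_neg]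
  obtain ⟨Φ, hΦ⟩ := exists_map_F f g p (RingHom.id (RatField k m)) ψ hψ hcdeg
  simp only [Polynomial.map_id] at hΦ
  refine ⟨Φ, ?_⟩
  rw [natDegree_F hdeg hp, ← hhdeg, ← natDegree_lift (k := k) (m := m) g]
  refine not_splits_and_exists_roots h2' (f := lift k₀ k m f) (g := lift k₀ k m g)
    (h := lift k₀ k m p + A.map i) (c := genericPoly k m - A.map i) (S := S.map i) (τ := i τ)
    ?_ ?_ ?_ ?_ ?_ hS.map ((IsAlgClosed.splits S).map i) ?_ ?_ L _ hψC ?_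
  · rw [hh, lift_eq_map, lift_eq_map]
    simpa using congrArg (Polynomial.map i) hF
  · rwa [lift_eq_map, hev, Ne, map_eq_zero]
  · rwa [hh, hev, Ne, map_eq_zero]
  · rw [eval_sub, hev, sub_ne_zero]
    exact eval_genericPoly_ne m τ _
  · rwa [hev, Ne, map_eq_zero]
  · rwa [natDegree_lift, natDegree_lift]
  · rw [hhdeg]; omega
  · rw [hΦ, hψX]
    simp only [Polynomial.map_add, Polynomial.map_sub, C_sub, C_1]
    ring

end Generic

end GenericShortInterval

theorem theorem2 {Fq : Type*} [Field Fq] [Finite Fq] (q : ℕ) (hq : Nat.card Fq = q)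
    (hodd : Odd q)
    (k : Type*) [Field k] [Algebra Fq k] [IsAlgClosure Fq k]
    (m : ℕ) (hm : 2 ≤ m)
    (f g p : Fq[X]) (hf : f ≠ 0) (hg : g.Monic) (hfg : IsCoprime f g)
    (hdeg : f.natDegree < g.natDegree)
    (hsq : ¬ IsSquare ((f * g).map (algebraMap Fq k)))
    (hp : m < p.natDegree)
    (n : ℕ) (hn : n = g.natDegree + 2 * p.natDegree) :
    (GenericShortInterval.F k m f g p).natDegree = n ∧
    (GenericShortInterval.F k m f g p).Separable ∧
    Function.Bijective
      (GenericShortInterval.galRootsHom (GenericShortInterval.F k m f g p)) ∧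
    Nonempty ((GenericShortInterval.F k m f g p).Gal ≃* Equiv.Perm (Fin n)) := by
  have : IsAlgClosed k := IsAlgClosure.isAlgClosed Fq
  have h2 : (2 : k) ≠ 0 := by
    have h1 : (2 : Fq) ≠ 0 := by
      intro h
      have hc : (Nat.card Fq : Fq) = 0 := by
        have := Fintype.ofFinite Fq
        rw [Nat.card_eq_fintype_card]
        exact FiniteField.cast_card_eq_zero Fq
      obtain ⟨a, ha⟩ := hodd
      rw [hq, ha] at hc
      push_cast at hc
      rw [h, zero_mul, zero_add] at hc
      exact one_ne_zero hc
    rw [← map_ofNat (algebraMap Fq k) 2, Ne, map_eq_zero]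
    exact h1
  have hirr := GenericShortInterval.irreducible_F (m := m) h2 hfg hdeg hsq hp
  have hnat := GenericShortInterval.natDegree_F (k := k) (m := m) hdeg hp
  obtain ⟨Φ, hns, hder, T, hT, hcard⟩ :=
    GenericShortInterval.exists_tangent_specialization (m := m) h2 hf hfg hdeg hsq hm hp
      (FractionRing (PowerSeries (GenericShortInterval.RatField k m)))
  have hstab := GenericShortInterval.exists_stabilizer_transitive_F (m := m) h2 hf hfg hdeg hsq
    (by omega) hp
  set P := GenericShortInterval.F k m f g p
  -- In positive characteristic irreducibility alone is not enough; the nonzero derivative comes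
  -- from the tangent specialization.
  have hsep : P.Separable := by
    rw [Polynomial.separable_iff_derivative_ne_zero hirr]
    intro h
    rw [Polynomial.derivative_map, h, Polynomial.map_zero] at hder
    exact hder rfl
  have hbij := GenericShortInterval.galRootsHom_bijective hirr hstab
    (GenericShortInterval.exists_swap_mem_range hsep Φ hns T hT hcard)
  refine ⟨hnat.trans hn.symm, hsep, hbij, ⟨(MulEquiv.ofBijective _ hbij).trans
    (Fintype.equivFinOfCardEq ?_).permCongrHom⟩⟩
  rw [Polynomial.card_rootSet_eq_natDegree hsep (Polynomial.SplittingField.splits P), hnat, hn]
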